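/- Let $R$ be an infinite integral domain with field of fractions $K$, let $a,b,c\in R\setminus\{0\}$ and let $n\ge 1$ be an integer. Suppose that $u,v\in R$, $v\neq 0$, are such that one of $\frac ac,\frac bc,\frac{a+b}c$ equals $\left(\frac uv\right)^n$ in $K$. (1) Let $p$ be any ultrafilter on $R$, other than the principal ultrafilter at $0$, with the following three properties: (i) for every $A\in p$ and $\ell\in\mathbb N$ there are $\beta,g\in A$ with $\{\beta g^j: 0\le j\le \ell\}\subseteq A$; (ii) for every $A\in p$ and $h,s\in R\setminus\{0\}$ there are $\alpha,d\in R$ with $\{hd,\,h\alpha,\,h\alpha+sd\}\subseteq A$; (iii) $\alpha R\in p$ for every $\alpha\in R\setminus\{0\}$. Put $q=p$ if $u=0$, and $$q=\tfrac uv\cdot p=\left\{A\subseteq R:\ \tfrac vu A\in p\right\},\qquad \tfrac vu A=\left\{r\in R:\ \tfrac uv r\in A\right\},$$ if $u\ne 0$. Then $q$ is an ultrafilter on $R$, and for every $A\in q$ there are $x,y,w,z\in A\setminus\{0\}$ with $ax+by=cwz^n$. (2) The equation $ax+by=cwz^n$ is partition regular over $R\setminus\{0\}$: for every finite partition $R\setminus\{0\}=C_1\cup\dots\cup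 C_r$ there are an $i$ and $x,y,w,z\in C_i$ with $ax+by=cwz^n$. -/

import Mathlib

namespace DomainPR

/-- The system of equations `f k x = 0` (`k : κ`), in unknowns `x j` (`j : ι`) ranging over `S`,
is partition regular over `S`: for any partition of `S` into finitely many pairwise disjoint cells,
one of the cells contains a solution. -/
def IsPartitionRegular {X R ι κ : Type*} [Zero R] (S : Set X) (f : κ → (ι → S) → R) : Prop :=
  ∀ (r : ℕ) (C : Fin r → Set X), Pairwise (Function.onFun Disjoint C) → (⋃ i, C i) = S →
    ∃ (i : Fin r) (x : ι → S), (∀ j, (x j : X) ∈ C i) ∧ ∀ k, f k x = 0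

/-- The class of ultrafilters `p ∈ βR ∖ {0}` under consideration (the point `0 ∈ βR` is the
principal ultrafilter at `0 ∈ R`). -/
structure IsSpecialUltrafilter {R : Type*} [CommRing R] (p : Ultrafilter R) : Prop where
  ne_pure_zero : p ≠ pure 0
  geometric : ∀ A ∈ p, ∀ l : ℕ, ∃ b ∈ A, ∃ g ∈ A, ∀ j ≤ l, b * g ^ j ∈ A
  linear : ∀ A ∈ p, ∀ h s : R, h ≠ 0 → s ≠ 0 →
    ∃ a d : R, h * d ∈ A ∧ h * a ∈ A ∧ h * a + s * d ∈ A
  multiples : ∀ α : R, α ≠ 0 → Set.range (fun r : R => α * r) ∈ p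

/-- For `A ⊆ R` and `t ≠ 0` in the field of fractions `K` of `R`, the set
`t A = {r ∈ R | t⁻¹ r ∈ A}`. -/
def dilate {R K : Type*} [CommRing R] [Field K] [Algebra R K] (t : K) (A : Set R) : Set R :=
  {r : R | ∃ x ∈ A, t⁻¹ * algebraMap R K r = algebraMap R K x}

/-- For an ultrafilter `p` on `R` and `t ≠ 0` in `K`, the family
`t · p = {A ⊆ R | t⁻¹ A ∈ p}`. -/
def scaledFamily {R K : Type*} [CommRing R] [Field K] [Algebra R K] (t : K) (p : Ultrafilter R) :
    Set (Set R) :=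
  {A : Set R | dilate t⁻¹ A ∈ p}

end DomainPR

namespace DomainPR

/-! Let `k` be the one of `a`, `b`, `a + b` with `k v ^ n = c u ^ n`. If `u ≠ 0`, scaling all
unknowns by `u / v` turns `a x + b y = c w z ^ n` into `a x + b y = k w z ^ n`, so `p` has to solve
the latter. By (i), in each member of `p` the products `w z ^ n` of its elements are `p`-large,
which leaves `a x + b y = k W`: an instance of (ii), or `x = y = W` if `k = a + b`. If `u = 0`, then
`b = -a` and (ii) applies directly.

For (2) a special `p` must exist. A colouring theorem of Brauer type, proved from Hales–Jewett, and
compactness give a nonempty closed set of ultrafilters with (ii) and (iii), invariant under nonzero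
multiplications. A minimal closed invariant subset is a compact semigroup; an idempotent in it also
satisfies (i). -/

/-! ### Sums and products along combinatorial lines. -/

theorem exists_forall_sum_ne_zero (R ι : Type*) [AddCommGroup R] [Infinite R] [Fintype ι] :
    ∃ s : ι → R, ∀ T : Finset ι, T.Nonempty → ∑ i ∈ T, s i ≠ 0 := by
  classical
  suffices h : ∀ U : Finset ι, ∃ s : ι → R, ∀ T ⊆ U, T.Nonempty → ∑ i ∈ T, s i ≠ 0 by
    obtain ⟨s, hs⟩ := h Finset.univ
    exact ⟨s, fun T hT => hs T (Finset.subset_univ T) hT⟩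
  intro U
  induction U using Finset.induction_on with
  | empty =>
    exact ⟨0, fun T hT hne => absurd (Finset.subset_empty.mp hT) hne.ne_empty⟩
  | insert a U ha ih =>
    obtain ⟨s, hs⟩ := ih
    obtain ⟨r, hr⟩ := Infinite.exists_notMem_finset (U.powerset.image fun T => -∑ i ∈ T, s i)
    have hup : ∀ T : Finset ι, a ∉ T → ∑ i ∈ T, Function.update s a r i = ∑ i ∈ T, s i :=
      fun T haT => Finset.sum_update_of_notMem haT s r
    refine ⟨Function.update s a r, fun T hT hne => ?_⟩
    by_cases haT : a ∈ T
    · rw [← Finset.add_sum_erase T _ haT, hup _ (Finset.notMem_erase a T), Function.update_self]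
      intro h0
      refine hr (Finset.mem_image.mpr ⟨T.erase a, ?_, (eq_neg_of_add_eq_zero_left h0).symm⟩)
      rw [Finset.mem_powerset]
      exact Finset.subset_insert_iff.mp hT
    · rw [hup T haT]
      exact hs T ((Finset.subset_insert_iff_of_notMem haT).mp hT) hne

/-- The fixed coordinates of the line contribute `a`, the active ones form `T`. -/
theorem exists_sum_line_eq {R ι : Type*} [CommSemiring R] [Fintype ι] {F : Finset R}
    (s : ι → R) (l : Combinatorics.Line F ι) :
    ∃ a : R, ∃ T : Finset ι, T.Nonempty ∧
      ∀ x : F, ∑ i, s i * (l x i : R) = a + x * ∑ i ∈ T, s i := by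
  classical
  obtain ⟨i₀, hi₀⟩ := l.proper
  refine ⟨∑ i with ¬ l.idxFun i = none, s i * (l.idxFun i).elim 0 (fun x => (x : R)),
    Finset.univ.filter fun i => l.idxFun i = none, ⟨i₀, by simp [hi₀]⟩, fun x => ?_⟩
  rw [← Finset.sum_filter_add_sum_filter_not Finset.univ (fun i => l.idxFun i = none), add_comm,
    Finset.mul_sum]
  congr 1
  · refine Finset.sum_congr rfl fun i hi => ?_
    obtain ⟨y, hy⟩ := Option.ne_none_iff_exists'.mp (Finset.mem_filter.mp hi).2
    simp [hy]
  · refine Finset.sum_congr rfl fun i hi => ?_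
    simp [(Finset.mem_filter.mp hi).2, mul_comm]

theorem exists_prod_line_eq {M ι : Type*} [CommMonoid M] [Fintype ι] {m : ℕ}
    (s : ι → M) (l : Combinatorics.Line (Fin m) ι) :
    ∃ a : M, ∃ T : Finset ι, T.Nonempty ∧
      ∀ x : Fin m, ∏ i, s i ^ (l x i : ℕ) = a * (∏ i ∈ T, s i) ^ (x : ℕ) := by
  classical
  obtain ⟨i₀, hi₀⟩ := l.proper
  refine ⟨∏ i with ¬ l.idxFun i = none, s i ^ (l.idxFun i).elim 0 (fun x => (x : ℕ)),
    Finset.univ.filter fun i => l.idxFun i = none, ⟨i₀, by simp [hi₀]⟩, fun x => ?_⟩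
  rw [← Finset.prod_filter_mul_prod_filter_not Finset.univ (fun i => l.idxFun i = none), mul_comm,
    ← Finset.prod_pow]
  congr 1
  · refine Finset.prod_congr rfl fun i hi => ?_
    obtain ⟨y, hy⟩ := Option.ne_none_iff_exists'.mp (Finset.mem_filter.mp hi).2
    simp [hy]
  · refine Finset.prod_congr rfl fun i hi => ?_
    simp [(Finset.mem_filter.mp hi).2]

/-! ### Monochromatic linear configurations. -/

/-- A finite form of the statement that `h a`, `h d`, `h a + t i d` can be found in one colour:
only the colours of `J` are used on the finite set `h E`. -/
theorem exists_finset_forall_coloring {R ι : Type*} [CommRing R] [IsDomain R] [Infinite R]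
    [Finite ι] (h : R) (hh : h ≠ 0) (t : ι → R) (k : ℕ) :
    ∀ J : Finset ι, J.card = k → ∃ E : Finset R, (∀ e ∈ E, e ≠ 0) ∧
      ∀ χ : R → ι, (∀ e ∈ E, χ (h * e) ∈ J) → ∃ i a d, a ≠ 0 ∧ d ≠ 0 ∧ h * a + t i * d ≠ 0 ∧
        χ (h * d) = i ∧ χ (h * a) = i ∧ χ (h * a + t i * d) = i := by
  classical
  have := Fintype.ofFinite ι
  induction k with
  | zero =>
    intro J hJ
    rw [Finset.card_eq_zero] at hJ
    subst hJ
    exact ⟨{1}, by simp, fun χ hχ => absurd (hχ 1 (by simp)) (by simp)⟩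
  | succ k ih =>
    intro J hJ
    have hE : ∀ i : ι, ∃ E : Finset R, (∀ e ∈ E, e ≠ 0) ∧ (i ∈ J →
        ∀ χ : R → ι, (∀ e ∈ E, χ (h * e) ∈ J.erase i) → ∃ i a d, a ≠ 0 ∧ d ≠ 0 ∧
          h * a + t i * d ≠ 0 ∧
          χ (h * d) = i ∧ χ (h * a) = i ∧ χ (h * a + t i * d) = i) := by
      intro i
      by_cases hi : i ∈ J
      · obtain ⟨E, hE0, hE⟩ := ih (J.erase i) (by rw [Finset.card_erase_of_mem hi, hJ]; rfl)
        exact ⟨E, hE0, fun _ => hE⟩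
      · exact ⟨∅, by simp, fun hi' => absurd hi' hi⟩
    choose E hE0 hE using hE
    -- The letters `t i * m` put `a + t i * m * σ` on the line with base `a` and step `σ`; `0` and
    -- `1` serve to show `a ≠ 0`.
    let F : Finset R := insert 0 (insert 1
      ((Finset.univ.biUnion E ×ˢ Finset.univ).image fun p : R × ι => t p.2 * p.1))
    have hF0 : (0 : R) ∈ F := by simp [F]
    have hF1 : (1 : R) ∈ F := by simp [F]
    have hFt : ∀ i j, ∀ m ∈ E j, t i * m ∈ F := by
      intro i j m hm
      refine Finset.mem_insert_of_mem (Finset.mem_insert_of_mem (Finset.mem_image.mpr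
        ⟨(m, i), ?_, rfl⟩))
      simpa using ⟨j, hm⟩
    obtain ⟨η, _, hη⟩ := Combinatorics.Line.exists_mono_in_high_dimension F (Option ι)
    -- With no vanishing subset sum, every line has a nonzero step.
    obtain ⟨s, hs⟩ := exists_forall_sum_ne_zero R η
    let X : (η → F) → R := fun w => ∑ i, s i * (w i : R)
    refine ⟨(Finset.univ.image X ∪ (Finset.univ.biUnion E ×ˢ Finset.univ).image
      fun p : R × Finset η => p.1 * (h * ∑ i ∈ p.2, s i)).erase 0,
      fun e he => Finset.ne_of_mem_erase he, fun χ hχ => ?_⟩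
    -- Zero gets a colour of its own. As `a` and `a + σ` are not both zero, a monochromatic line
    -- avoids zero altogether.
    obtain ⟨l, c, hc⟩ := hη fun w => if X w = 0 then none else some (χ (h * X w))
    obtain ⟨a, T, hT, hl⟩ := exists_sum_line_eq s l
    have hσ := hs T hT
    set σ := ∑ i ∈ T, s i
    have hl : ∀ x : F, X (l x) = a + x * σ := hl
    simp only [hl] at hc
    have hc0 := hc ⟨0, hF0⟩
    have hc1 := hc ⟨1, hF1⟩
    simp only [zero_mul, add_zero, one_mul] at hc0 hc1
    have ha : a ≠ 0 := by
      rintro rfl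
      rw [if_pos rfl] at hc0
      rw [← hc0, zero_add, if_neg hσ] at hc1
      cases hc1
    rw [if_neg ha] at hc0
    set i := χ (h * a) with hi
    have hx : ∀ x ∈ F, a + x * σ ≠ 0 ∧ χ (h * (a + x * σ)) = i := by
      intro x hx
      have := hc ⟨x, hx⟩
      rw [← hc0] at this
      by_cases h0 : a + x * σ = 0
      · simp [h0] at this
      · exact ⟨h0, by simpa [h0] using this⟩
    have hiJ : i ∈ J := by
      refine hχ a (Finset.mem_erase.mpr ⟨ha, Finset.mem_union_left _ (Finset.mem_image.mpr
        ⟨l ⟨0, hF0⟩, Finset.mem_univ _, ?_⟩)⟩)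
      rw [hl]; simp
    -- Either some `d = m * (h * σ)` completes the configuration in colour `i`, or `i` is absent
    -- from the dilate of `h * E i` by `h * σ`, and induction applies there with one colour fewer.
    by_cases hm : ∃ m ∈ E i, χ (h * (m * (h * σ))) = i
    · obtain ⟨m, hmE, hm⟩ := hm
      obtain ⟨h1, h2⟩ := hx _ (hFt i i m hmE)
      have heq : h * a + t i * (m * (h * σ)) = h * (a + t i * m * σ) := by ring
      exact ⟨i, a, m * (h * σ), ha, mul_ne_zero (hE0 i m hmE) (mul_ne_zero hh hσ),
        heq ▸ mul_ne_zero hh h1, hm, hi.symm, heq ▸ h2⟩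
    · push Not at hm
      obtain ⟨i', a', d', ha', hd', h0, h1, h2, h3⟩ := hE i hiJ (fun x => χ (x * (h * σ))) (by
        intro e he
        have hne : e * (h * σ) ≠ 0 := mul_ne_zero (hE0 i e he) (mul_ne_zero hh hσ)
        rw [mul_assoc]
        refine Finset.mem_erase.mpr ⟨hm e he, hχ _ (Finset.mem_erase.mpr ⟨hne,
          Finset.mem_union_right _ (Finset.mem_image.mpr ⟨(e, T), ?_, rfl⟩)⟩)⟩
        simpa using ⟨i, he⟩)
      have hhσ := mul_ne_zero hh hσ
      have heq : h * (a' * (h * σ)) + t i' * (d' * (h * σ)) = (h * a' + t i' * d') * (h * σ) := by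
        ring
      refine ⟨i', a' * (h * σ), d' * (h * σ), mul_ne_zero ha' hhσ, mul_ne_zero hd' hhσ, ?_, ?_, ?_,
        ?_⟩
      · rw [heq]; exact mul_ne_zero h0 hhσ
      · rw [← mul_assoc]; exact h1
      · rw [← mul_assoc]; exact h2
      · rw [heq]; exact h3

theorem exists_mono_linear {R ι : Type*} [CommRing R] [IsDomain R] [Infinite R]
    [Finite ι] (h : R) (hh : h ≠ 0) (t : ι → R) (χ : R → ι) :
    ∃ i a d, a ≠ 0 ∧ d ≠ 0 ∧ h * a + t i * d ≠ 0 ∧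
      χ (h * d) = i ∧ χ (h * a) = i ∧ χ (h * a + t i * d) = i := by
  have := Fintype.ofFinite ι
  obtain ⟨E, -, hE⟩ := exists_finset_forall_coloring h hh t _ Finset.univ rfl
  exact hE χ fun e _ => Finset.mem_univ _

/-! ### Ultrafilters with linearly rich members. -/

open Filter

attribute [local instance] Ultrafilter.mul Ultrafilter.semigroup

/-- `A` contains `h d`, `h a`, `h a + s d` for suitable `a`, `d`, whenever `h` and `s` are
nonzero. -/
def IsLinearlyRich {R : Type*} [CommRing R] (A : Set R) : Prop :=
  ∀ h s : R, h ≠ 0 → s ≠ 0 → ∃ a d : R, h * d ∈ A ∧ h * a ∈ A ∧ h * a + s * d ∈ A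

/-- The sets that belong to an ultrafilter `p` exactly when `p` does not contain `{0}`, contains
all nonzero principal ideals, and consists of linearly rich sets. -/
def linearSubbasis (R : Type*) [CommRing R] : Set (Set R) :=
  {B | B = {0}ᶜ ∨ (∃ α : R, α ≠ 0 ∧ B = Set.range fun r : R => α * r) ∨ ¬ IsLinearlyRich Bᶜ}

/-- If the intersection were empty, each `x` could be coloured by a `B` missing it. A monochromatic
configuration, made divisible by all the `α B` and `h B`, contradicts the defining property of its
colour. The parameter `s B` varies with the colour, hence the family `t` in `exists_mono_linear`. -/
theorem sInter_nonempty_of_subset_linearSubbasis {R : Type*} [CommRing R] [IsDomain R] [Infinite R]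
    {t : Set (Set R)} (ht : t ⊆ linearSubbasis R) (hfin : t.Finite) : (⋂₀ t).Nonempty := by
  classical
  by_contra hempty
  have hcov : ∀ x : R, ∃ B : t, x ∉ (B : Set R) := by
    intro x
    by_contra! hx
    exact hempty ⟨x, fun B hB => hx ⟨B, hB⟩⟩
  choose χ hχ using hcov
  have hdata : ∀ B : t, ∃ α h s : R, α ≠ 0 ∧ h ≠ 0 ∧ s ≠ 0 ∧ ((B : Set R) = {0}ᶜ ∨
      ((B : Set R) = Set.range fun r : R => α * r) ∨
      ¬ ∃ a d : R, h * d ∈ (B : Set R)ᶜ ∧ h * a ∈ (B : Set R)ᶜ ∧ h * a + s * d ∈ (B : Set R)ᶜ) := by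
    rintro ⟨B, hB⟩
    rcases ht hB with h | ⟨α, hα, h⟩ | h
    · exact ⟨1, 1, 1, one_ne_zero, one_ne_zero, one_ne_zero, .inl h⟩
    · exact ⟨α, 1, 1, hα, one_ne_zero, one_ne_zero, .inr (.inl h)⟩
    · unfold IsLinearlyRich at h
      push Not at h
      obtain ⟨h, s, hh, hs, hn⟩ := h
      refine ⟨1, h, s, one_ne_zero, hh, hs, .inr (.inr ?_)⟩
      push Not
      exact hn
  choose α h s hα hh hs hB using hdata
  have : Fintype t := hfin.fintype
  have hdvd : ∀ B, ∃ k, ∏ B, h B = h B * k := fun B => Finset.dvd_prod_of_mem h (Finset.mem_univ B)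
  have hdvdα : ∀ B, ∃ k, ∏ B, α B = α B * k := fun B =>
    Finset.dvd_prod_of_mem α (Finset.mem_univ B)
  choose k hk using hdvd
  choose m hm using hdvdα
  have hH : ∏ B, h B ≠ 0 := Finset.prod_ne_zero_iff.mpr fun B _ => hh B
  have hα0 : ∏ B, α B ≠ 0 := Finset.prod_ne_zero_iff.mpr fun B _ => hα B
  obtain ⟨B, a, d, ha, hd, -, h1, h2, h3⟩ :=
    exists_mono_linear (∏ B, h B) hH (fun B => s B * k B) fun x => χ ((∏ B, α B) * x)
  have h1' := hχ ((∏ B, α B) * ((∏ B, h B) * d))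
  rw [h1] at h1'
  have h2' := hχ ((∏ B, α B) * ((∏ B, h B) * a))
  rw [h2] at h2'
  have h3' := hχ ((∏ B, α B) * ((∏ B, h B) * a + s B * k B * d))
  rw [h3] at h3'
  rcases hB B with hB | hB | hB
  · rw [hB] at h1'
    exact h1' (mul_ne_zero hα0 (mul_ne_zero hH hd))
  · rw [hB] at h1'
    refine h1' ⟨m B * ((∏ B, h B) * d), ?_⟩
    simp only
    rw [hm B]; ring
  · have e1 : ∀ x, h B * ((∏ B, α B) * (k B * x)) = (∏ B, α B) * ((∏ B, h B) * x) := fun x => by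
      rw [hk B]; ring
    refine hB ⟨(∏ B, α B) * (k B * a), (∏ B, α B) * (k B * d), ?_, ?_, ?_⟩
    · rw [e1]; exact h1'
    · rw [e1]; exact h2'
    · rw [e1, show s B * ((∏ B, α B) * (k B * d)) = (∏ B, α B) * (s B * k B * d) by ring, ← mul_add]
      exact h3'

/-- The ultrafilters that differ from the principal one at `0`, contain all nonzero principal
ideals, and consist of linearly rich sets. -/
def linearUltrafilters (R : Type*) [CommRing R] : Set (Ultrafilter R) :=
  {p | ∀ B ∈ linearSubbasis R, B ∈ p}

theorem linearUltrafilters_nonempty (R : Type*) [CommRing R] [IsDomain R] [Infinite R] :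
    (linearUltrafilters R).Nonempty := by
  have : NeBot (Filter.generate (linearSubbasis R)) :=
    Filter.generate_neBot_iff.mpr fun t ht hfin => sInter_nonempty_of_subset_linearSubbasis ht hfin
  refine ⟨Ultrafilter.of (Filter.generate (linearSubbasis R)), fun B hB => ?_⟩
  exact Ultrafilter.of_le _ (Filter.mem_generate_of_mem hB)

theorem isClosed_linearUltrafilters (R : Type*) [CommRing R] : IsClosed (linearUltrafilters R) := by
  have : linearUltrafilters R = ⋂ B ∈ linearSubbasis R, {p : Ultrafilter R | B ∈ p} := by
    ext p; simp [linearUltrafilters]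
  rw [this]
  exact isClosed_biInter fun B _ => ultrafilter_isClosed_basic B

theorem isLinearlyRich_of_mem {R : Type*} [CommRing R] {p : Ultrafilter R}
    (hp : p ∈ linearUltrafilters R) {A : Set R} (hA : A ∈ p) : IsLinearlyRich A := by
  by_contra h
  exact Ultrafilter.compl_notMem_iff.mpr hA (hp Aᶜ (.inr (.inr (by rwa [compl_compl]))))

theorem mem_linearUltrafilters_iff {R : Type*} [CommRing R] {p : Ultrafilter R} :
    p ∈ linearUltrafilters R ↔ ({0}ᶜ : Set R) ∈ p ∧
      (∀ α : R, α ≠ 0 → Set.range (fun r : R => α * r) ∈ p) ∧ ∀ A ∈ p, IsLinearlyRich A := by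
  refine ⟨fun hp => ⟨hp _ (.inl rfl), fun α hα => hp _ (.inr (.inl ⟨α, hα, rfl⟩)),
    fun A hA => isLinearlyRich_of_mem hp hA⟩, ?_⟩
  rintro ⟨h0, hα, hA⟩ B (rfl | ⟨α, h, rfl⟩ | h)
  · exact h0
  · exact hα α h
  · by_contra hB
    exact h (hA _ (Ultrafilter.compl_mem_iff_notMem.mpr hB))

theorem mem_pure_mul_iff {M : Type*} [Mul M] (r : M) (p : Ultrafilter M) (A : Set M) :
    A ∈ (pure r : Ultrafilter M) * p ↔ {x | r * x ∈ A} ∈ p := Iff.rfl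

theorem pure_mul_mem_linearUltrafilters {R : Type*} [CommRing R] [IsDomain R] {p : Ultrafilter R}
    (hp : p ∈ linearUltrafilters R) {r : R} (hr : r ≠ 0) :
    (pure r : Ultrafilter R) * p ∈ linearUltrafilters R := by
  rw [mem_linearUltrafilters_iff] at hp ⊢
  obtain ⟨h0, hα, hA⟩ := hp
  refine ⟨?_, fun α h => ?_, fun A h g s hg hs => ?_⟩
  · rw [mem_pure_mul_iff]
    exact mem_of_superset h0 fun x hx => mul_ne_zero hr hx
  · rw [mem_pure_mul_iff]
    refine mem_of_superset (hα α h) ?_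
    rintro _ ⟨y, rfl⟩
    exact ⟨r * y, by ring⟩
  · rw [mem_pure_mul_iff] at h
    obtain ⟨a, d, h1, h2, h3⟩ := hA _ h g s hg hs
    have e1 : ∀ x y : R, x * (r * y) = r * (x * y) := fun x y => by ring
    refine ⟨r * a, r * d, ?_, ?_, ?_⟩
    · rw [e1]; exact h1
    · rw [e1]; exact h2
    · rw [e1, e1, ← mul_add]; exact h3

/-! ### Minimal invariant sets and geometric progressions. -/

/-- The nonempty closed sets of ultrafilters on `R` that satisfy the linear conditions and are
invariant under multiplication by the nonzero elements of `R`. -/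
def invariantSets (R : Type*) [CommRing R] : Set (Set (Ultrafilter R)) :=
  {N | IsClosed N ∧ N.Nonempty ∧ N ⊆ linearUltrafilters R ∧
    ∀ p ∈ N, ∀ r : R, r ≠ 0 → (pure r : Ultrafilter R) * p ∈ N}

theorem exists_minimal_invariantSets (R : Type*) [CommRing R] [IsDomain R] [Infinite R] :
    ∃ N, Minimal (· ∈ invariantSets R) N := by
  have htop : linearUltrafilters R ∈ invariantSets R :=
    ⟨isClosed_linearUltrafilters R, linearUltrafilters_nonempty R, subset_rfl,
      fun p hp r hr => pure_mul_mem_linearUltrafilters hp hr⟩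
  refine zorn_superset _ fun c hcs hc => ?_
  obtain rfl | hne := c.eq_empty_or_nonempty
  · exact ⟨_, htop, by simp⟩
  obtain ⟨N₀, hN₀⟩ := hne
  refine ⟨⋂₀ c, ⟨isClosed_sInter fun t ht => (hcs ht).1, ?_,
    (Set.sInter_subset_of_mem hN₀).trans (hcs hN₀).2.2.1, fun p hp r hr t ht =>
      (hcs ht).2.2.2 p (hp t ht) r hr⟩, fun s hs => Set.sInter_subset_of_mem hs⟩
  rw [Set.sInter_eq_iInter]
  have : Nonempty c := ⟨⟨N₀, hN₀⟩⟩
  exact IsCompact.nonempty_iInter_of_directed_nonempty_isCompact_isClosed _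
    (DirectedOn.directed_val (IsChain.directedOn hc.symm)) (fun i => (hcs i.prop).2.1)
    (fun i => (hcs i.prop).1.isCompact) fun i => (hcs i.prop).1

/-- The product `q * p` is the limit of `pure r * p` as `r` tends to `q` through nonzero elements.
-/
theorem mul_mem_of_isClosed {R : Type*} [CommRing R] {N : Set (Ultrafilter R)} (hN : IsClosed N)
    {p q : Ultrafilter R} (hinv : ∀ r : R, r ≠ 0 → (pure r : Ultrafilter R) * p ∈ N)
    (hq : ({0}ᶜ : Set R) ∈ q) : q * p ∈ N := by
  by_contra hqp
  obtain ⟨U, ⟨A, rfl⟩, hA, hU⟩ := ultrafilterBasis_is_basis.exists_subset_of_mem_open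
    (show q * p ∈ Nᶜ from hqp) hN.isOpen_compl
  have hA' : {m | {x | m * x ∈ A} ∈ p} ∈ q := hA
  obtain ⟨r, hr, hr0⟩ := Ultrafilter.nonempty_of_mem (inter_mem hA' hq)
  exact hU (show A ∈ (pure r : Ultrafilter R) * p from hr) (hinv r hr0)

/-- By minimality every orbit is dense in `N`. -/
theorem exists_mem_pure_mul_of_minimal {R : Type*} [CommRing R] [IsDomain R]
    {N : Set (Ultrafilter R)} (hN : Minimal (· ∈ invariantSets R) N) {p e : Ultrafilter R}
    (hp : p ∈ N) (he : e ∈ N) {A : Set R} (hA : A ∈ e) :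
    ∃ r : R, r ≠ 0 ∧ A ∈ (pure r : Ultrafilter R) * p := by
  by_contra! hr
  -- the elements of `N` all of whose nonzero multiples avoid `A` form an invariant set
  obtain ⟨hcl, -, hlin, hinv⟩ := hN.prop
  have hmem : {p ∈ N | ∀ r : R, r ≠ 0 → Aᶜ ∈ (pure r : Ultrafilter R) * p} ∈ invariantSets R := by
    refine ⟨?_, ⟨p, hp, fun r h => Ultrafilter.compl_mem_iff_notMem.mpr (hr r h)⟩,
      fun p hp => hlin hp.1, fun p hp r h => ⟨hinv p hp.1 r h, fun r' h' => ?_⟩⟩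
    · refine hcl.inter ?_
      have : {p : Ultrafilter R | ∀ r : R, r ≠ 0 → Aᶜ ∈ (pure r : Ultrafilter R) * p} =
          ⋂ (r : R) (_ : r ≠ 0), {p : Ultrafilter R | {x | r * x ∈ Aᶜ} ∈ p} := by
        ext p; simp only [Set.mem_iInter]; rfl
      change IsClosed {p : Ultrafilter R | ∀ r : R, r ≠ 0 → Aᶜ ∈ (pure r : Ultrafilter R) * p}
      rw [this]
      exact isClosed_biInter fun r _ => ultrafilter_isClosed_basic _
    · have := hp.2 (r' * r) (mul_ne_zero h' h)
      rw [mem_pure_mul_iff] at this ⊢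
      rw [mem_pure_mul_iff]
      simpa [mul_assoc] using this
  have he' := (hN.le_of_le hmem (fun p hp => hp.1) he).2 1 one_ne_zero
  rw [mem_pure_mul_iff] at he'
  simp only [one_mul] at he'
  exact Ultrafilter.compl_notMem_iff.mpr hA he'

/-- By density and compactness, finitely many multipliers `r` carry a set of every `p ∈ N` into `A`.
Colour `x ≠ 0` by an `r` that works for `pure x * e`. Hales–Jewett on products of a sequence whose
finite products lie in `A` gives `c * g ^ j`, `j ≤ l`, of one colour `r`; a common `y` then puts all
`r * c * y * g ^ j` in `A`. -/
theorem exists_geometric_of_minimal {R : Type*} [CommRing R] [IsDomain R]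
    {N : Set (Ultrafilter R)} (hN : Minimal (· ∈ invariantSets R) N) {e : Ultrafilter R}
    (he : e ∈ N) (hee : e * e = e) {A : Set R} (hA : A ∈ e) (l : ℕ) :
    ∃ b ∈ A, ∃ g ∈ A, ∀ j ≤ l, b * g ^ j ∈ A := by
  obtain ⟨hcl, -, hlin, hinv⟩ := hN.prop
  have h0 : ({0}ᶜ : Set R) ∈ e := (mem_linearUltrafilters_iff.mp (hlin he)).1
  obtain ⟨u, hu⟩ := hcl.isCompact.elim_finite_subcover
    (fun r : {r : R // r ≠ 0} => {p : Ultrafilter R | {x | r.1 * x ∈ A} ∈ p})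
    (fun r => ultrafilter_isOpen_basic _) (by
      intro p hp
      obtain ⟨r, hr, h⟩ := exists_mem_pure_mul_of_minimal hN hp he hA
      exact Set.mem_iUnion.mpr ⟨⟨r, hr⟩, h⟩)
  have hcov : ∀ p ∈ N, ∃ r : u, {x | r.1.1 * x ∈ A} ∈ p := by
    intro p hp
    obtain ⟨r, hr, h⟩ := Set.mem_iUnion₂.mp (hu hp)
    exact ⟨⟨r, hr⟩, h⟩
  obtain ⟨a, ha⟩ := Hindman.exists_FP_of_large e hee (A ∩ {0}ᶜ) (inter_mem hA h0)
  have hcol : ∀ x : R, ∃ r : u, x ≠ 0 → {y | r.1.1 * (x * y) ∈ A} ∈ e := by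
    intro x
    by_cases hx : x = 0
    · obtain ⟨r, -⟩ := hcov e he
      exact ⟨r, fun h => absurd hx h⟩
    · obtain ⟨r, h⟩ := hcov _ (hinv e he x hx)
      exact ⟨r, fun _ => h⟩
  choose χ hχ using hcol
  obtain ⟨η, _, hη⟩ := Combinatorics.Line.exists_mono_in_high_dimension (Fin (l + 1)) u
  let idx : η ↪ ℕ := (Fintype.equivFin η).toEmbedding.trans Fin.valEmbedding
  have hprod : ∀ T : Finset η, T.Nonempty → ∏ i ∈ T, a.get (idx i) ∈ A ∩ {0}ᶜ := by
    intro T hT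
    have := ha (Hindman.FP.finsetProd a (T.map idx) (hT.map))
    rwa [Finset.prod_map] at this
  let X : (η → Fin (l + 1)) → R := fun w => ∏ i, a.get (idx i) ^ (w i : ℕ)
  have hX : ∀ w, X w ≠ 0 := fun w => Finset.prod_ne_zero_iff.mpr fun i _ => pow_ne_zero _ (by
    simpa using (hprod {i} (Finset.singleton_nonempty i)).2)
  obtain ⟨L, r, hr⟩ := hη fun w => χ (X w)
  obtain ⟨c, T, hT, hL⟩ := exists_prod_line_eq (fun i => a.get (idx i)) L
  have hall : ∀ᶠ y in (e : Filter R), ∀ j : Fin (l + 1), r.1.1 * (X (L j) * y) ∈ A := by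
    rw [eventually_all]
    intro j
    have := hχ (X (L j)) (hX _)
    rw [show χ (X (L j)) = r from hr j] at this
    exact this
  obtain ⟨y, hy⟩ := hall.exists
  have key : ∀ j ≤ l, r.1.1 * c * y * (∏ i ∈ T, a.get (idx i)) ^ j ∈ A := by
    intro j hj
    have h := hy ⟨j, Nat.lt_succ_of_le hj⟩
    have h' : X (L ⟨j, Nat.lt_succ_of_le hj⟩) = c * (∏ i ∈ T, a.get (idx i)) ^ j := hL _
    rw [h'] at h
    convert h using 1
    ring
  exact ⟨r.1.1 * c * y, by simpa using key 0 (Nat.zero_le l), _, (hprod T hT).1, key⟩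

theorem exists_isSpecialUltrafilter (R : Type*) [CommRing R] [IsDomain R] [Infinite R] :
    ∃ p : Ultrafilter R, IsSpecialUltrafilter p := by
  obtain ⟨N, hN⟩ := exists_minimal_invariantSets R
  obtain ⟨hcl, hne, hlin, hinv⟩ := hN.prop
  obtain ⟨e, he, hee⟩ := exists_idempotent_in_compact_subsemigroup
    Ultrafilter.continuous_mul_left N hne hcl.isCompact fun q hq p hp =>
      mul_mem_of_isClosed hcl (hinv p hp) (mem_linearUltrafilters_iff.mp (hlin hq)).1
  obtain ⟨h0, hα, hA⟩ := mem_linearUltrafilters_iff.mp (hlin he)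
  refine ⟨e, ?_, fun A hA l => exists_geometric_of_minimal hN he hee hA l, hA, hα⟩
  rintro rfl
  exact h0 rfl

/-! ### Solutions inside members of a special ultrafilter. -/

theorem IsSpecialUltrafilter.compl_zero_mem {R : Type*} [CommRing R] {p : Ultrafilter R}
    (hp : IsSpecialUltrafilter p) : ({0}ᶜ : Set R) ∈ p := by
  rw [Ultrafilter.compl_mem_iff_notMem]
  intro h
  exact hp.ne_pure_zero (Ultrafilter.coe_le_coe.mp (le_pure_iff.mpr h))

/-- The members of `B` that are a product `w z ^ n` with `w`, `z` in `B` form a large set. -/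
theorem IsSpecialUltrafilter.setOf_mul_pow_mem {R : Type*} [CommRing R] {p : Ultrafilter R}
    (hp : IsSpecialUltrafilter p) {B : Set R} (hB : B ∈ p) (n : ℕ) :
    {W ∈ B | ∃ w ∈ B, ∃ z ∈ B, W = w * z ^ n} ∈ p := by
  by_contra h
  obtain ⟨b, hb, g, hg, hbg⟩ := hp.geometric _
    (inter_mem hB (Ultrafilter.compl_mem_iff_notMem.mpr h)) n
  exact (hbg n le_rfl).2 ⟨(hbg n le_rfl).1, b, hb.1, g, hg.1, rfl⟩

theorem IsSpecialUltrafilter.exists_add_eq {R : Type*} [CommRing R] {p : Ultrafilter R}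
    (hp : IsSpecialUltrafilter p) {B : Set R} (hB : B ∈ p) {a b : R} (ha : a ≠ 0) (hb : b ≠ 0) :
    ∃ x ∈ B, ∃ y ∈ B, ∃ W ∈ B, a * x + b * y = a * W := by
  obtain ⟨e, d, h1, h2, h3⟩ := hp.linear B hB a b ha hb
  exact ⟨_, h2, _, h1, _, h3, by ring⟩

theorem IsSpecialUltrafilter.exists_mul_add_mul_eq {R : Type*} [CommRing R] {p : Ultrafilter R}
    (hp : IsSpecialUltrafilter p) {B : Set R} (hB : B ∈ p) {a b k : R} (ha : a ≠ 0) (hb : b ≠ 0)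
    (hk : k = a ∨ k = b ∨ k = a + b) (n : ℕ) :
    ∃ x ∈ B, ∃ y ∈ B, ∃ w ∈ B, ∃ z ∈ B, a * x + b * y = k * (w * z ^ n) := by
  have hB' := hp.setOf_mul_pow_mem hB n
  rcases hk with rfl | rfl | rfl
  · obtain ⟨x, hx, y, hy, _, ⟨-, w, hw, z, hz, rfl⟩, h⟩ := hp.exists_add_eq hB' ha hb
    exact ⟨x, hx.1, y, hy.1, w, hw, z, hz, h⟩
  · obtain ⟨y, hy, x, hx, _, ⟨-, w, hw, z, hz, rfl⟩, h⟩ := hp.exists_add_eq hB' hb ha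
    exact ⟨x, hx.1, y, hy.1, w, hw, z, hz, by rw [add_comm, h]⟩
  · obtain ⟨W, hW, w, hw, z, hz, rfl⟩ := Ultrafilter.nonempty_of_mem hB'
    exact ⟨_, hW, _, hW, w, hw, z, hz, by ring⟩

/-- This serves `u = 0`, where `b = -a`. Here `a * d` is the product `w * z ^ n`, and `x - y = c *
d`. -/
theorem IsSpecialUltrafilter.exists_mul_sub_eq {R : Type*} [CommRing R] {p : Ultrafilter R}
    (hp : IsSpecialUltrafilter p) {B : Set R} (hB : B ∈ p) {a c : R} (ha : a ≠ 0) (hc : c ≠ 0)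
    (n : ℕ) :
    ∃ x ∈ B, ∃ y ∈ B, ∃ w ∈ B, ∃ z ∈ B, a * x - a * y = c * (w * z ^ n) := by
  obtain ⟨e, d, ⟨-, w, hw, z, hz, h1⟩, h2, h3⟩ :=
    hp.linear _ (hp.setOf_mul_pow_mem hB n) a c ha hc
  exact ⟨_, h3.1, _, h2.1, w, hw, z, hz, by rw [← h1]; ring⟩

/-! ### Dilation by `u / v`. -/

theorem exists_ultrafilter_scaledFamily {R K : Type*} [CommRing R] [IsDomain R] [Field K]
    [Algebra R K] [IsFractionRing R K] {u v : R} (hv : v ≠ 0) {p : Ultrafilter R}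
    (hp : Set.range (fun r : R => v * r) ∈ p) :
    ∃ q : Ultrafilter R, ∀ A : Set R,
      A ∈ q ↔ A ∈ scaledFamily (algebraMap R K u / algebraMap R K v) p := by
  classical
  -- Multiplication by `u / v` on `vR`; the value `0` elsewhere is harmless because `vR ∈ p`.
  let f : R → R := fun r => if h : ∃ s, v * s = r then u * h.choose else 0
  have hf : ∀ s, f (v * s) = u * s := by
    intro s
    have h : ∃ s', v * s' = v * s := ⟨s, rfl⟩
    have := mul_left_cancel₀ hv h.choose_spec
    simp only [f, dif_pos h, this]
  have hv' : algebraMap R K v ≠ 0 := by simpa using hv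
  refine ⟨p.map f, fun A => ?_⟩
  rw [Ultrafilter.mem_map]
  refine congr_sets (f := (p : Filter R)) ?_
  filter_upwards [hp]
  rintro _ ⟨s, rfl⟩
  have hs : algebraMap R K u / algebraMap R K v * algebraMap R K (v * s) =
      algebraMap R K (u * s) := by
    rw [map_mul, map_mul]; field_simp
  simp only [dilate, Set.mem_preimage, Set.mem_ofPred_eq, inv_inv, hs, hf]
  refine ⟨fun h => ⟨_, h, rfl⟩, ?_⟩
  rintro ⟨x, hx, h⟩
  rwa [IsFractionRing.injective R K h]

theorem exists_solution_of_mem_scaledFamily {R K : Type*} [CommRing R] [IsDomain R] [Field K]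
    [Algebra R K] [IsFractionRing R K] {a b c k u v : R} (ha : a ≠ 0) (hb : b ≠ 0)
    (hk : k = a ∨ k = b ∨ k = a + b) (hu : u ≠ 0) (hv : v ≠ 0) {n : ℕ}
    (huv : k * v ^ n = c * u ^ n) {p : Ultrafilter R} (hp : IsSpecialUltrafilter p) {A : Set R}
    (hA : A ∈ scaledFamily (algebraMap R K u / algebraMap R K v) p) :
    ∃ x ∈ A \ {0}, ∃ y ∈ A \ {0}, ∃ w ∈ A \ {0}, ∃ z ∈ A \ {0},
      a * x + b * y = c * w * z ^ n := by
  have hv' : algebraMap R K v ≠ 0 := by simpa using hv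
  have hlift : ∀ r ∈ dilate (algebraMap R K u / algebraMap R K v)⁻¹ A ∩ {0}ᶜ,
      ∃ x ∈ A \ {0}, v * x = u * r := by
    rintro r ⟨⟨x, hx, h⟩, hr⟩
    have hxr : v * x = u * r := by
      apply IsFractionRing.injective R K
      rw [map_mul, map_mul, ← h, inv_inv]
      field_simp
    refine ⟨x, ⟨hx, ?_⟩, hxr⟩
    rintro rfl
    rw [mul_zero] at hxr
    exact mul_ne_zero hu hr hxr.symm
  obtain ⟨x', hx', y', hy', w', hw', z', hz', h⟩ :=
    hp.exists_mul_add_mul_eq (inter_mem hA hp.compl_zero_mem) ha hb hk n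
  obtain ⟨x, hx, ex⟩ := hlift x' hx'
  obtain ⟨y, hy, ey⟩ := hlift y' hy'
  obtain ⟨w, hw, ew⟩ := hlift w' hw'
  obtain ⟨z, hz, ez⟩ := hlift z' hz'
  refine ⟨x, hx, y, hy, w, hw, z, hz, mul_left_cancel₀ (pow_ne_zero (n + 1) hv) ?_⟩
  calc v ^ (n + 1) * (a * x + b * y) = v ^ n * (a * (v * x) + b * (v * y)) := by ring
    _ = v ^ n * u * (a * x' + b * y') := by rw [ex, ey]; ring
    _ = (k * v ^ n) * u * (w' * z' ^ n) := by rw [h]; ring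
    _ = c * (u * w') * (u * z') ^ n := by rw [huv]; ring
    _ = v ^ (n + 1) * (c * w * z ^ n) := by rw [← ew, ← ez]; ring

end DomainPR

/-! ### The main theorem. -/

theorem mainTheorem4 {R : Type*} [CommRing R] [IsDomain R] [Infinite R]
    {K : Type*} [Field K] [Algebra R K] [IsFractionRing R K]
    (a b c : R) (ha : a ≠ 0) (hb : b ≠ 0) (hc : c ≠ 0) (n : ℕ) (hn : 0 < n)
    (u v : R) (hv : v ≠ 0)
    (huv : algebraMap R K a / algebraMap R K c = (algebraMap R K u / algebraMap R K v) ^ n ∨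
      algebraMap R K b / algebraMap R K c = (algebraMap R K u / algebraMap R K v) ^ n ∨
      algebraMap R K (a + b) / algebraMap R K c = (algebraMap R K u / algebraMap R K v) ^ n) :
    (∀ p : Ultrafilter R, DomainPR.IsSpecialUltrafilter p →
      ∃ q : Ultrafilter R,
        (u = 0 → q = p) ∧
        (u ≠ 0 → ∀ A : Set R,
          A ∈ q ↔ A ∈ DomainPR.scaledFamily (algebraMap R K u / algebraMap R K v) p) ∧
        ∀ A ∈ q, ∃ x ∈ A \ {0}, ∃ y ∈ A \ {0}, ∃ w ∈ A \ {0}, ∃ z ∈ A \ {0},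
          a * x + b * y = c * w * z ^ n) ∧
    DomainPR.IsPartitionRegular ({0}ᶜ : Set R)
      (fun (_ : Fin 1) (t : Fin 4 → ({0}ᶜ : Set R)) =>
        a * (t 0 : R) + b * (t 1 : R) - c * (t 2 : R) * (t 3 : R) ^ n) := by
  have hkey : ∃ k, (k = a ∨ k = b ∨ k = a + b) ∧ k * v ^ n = c * u ^ n := by
    have hconv : ∀ k : R, algebraMap R K k / algebraMap R K c =
        (algebraMap R K u / algebraMap R K v) ^ n → k * v ^ n = c * u ^ n := by
      intro k h
      have hv' : algebraMap R K v ≠ 0 := by simpa using hv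
      have hc' : algebraMap R K c ≠ 0 := by simpa using hc
      rw [div_pow, div_eq_div_iff hc' (pow_ne_zero n hv')] at h
      apply IsFractionRing.injective R K
      rw [map_mul, map_mul, map_pow, map_pow, h, mul_comm]
    rcases huv with h | h | h
    exacts [⟨a, by simp, hconv a h⟩, ⟨b, by simp, hconv b h⟩, ⟨a + b, by simp, hconv _ h⟩]
  obtain ⟨k, hk, hkuv⟩ := hkey
  have hmain : ∀ p : Ultrafilter R, DomainPR.IsSpecialUltrafilter p →
      ∃ q : Ultrafilter R,
        (u = 0 → q = p) ∧
        (u ≠ 0 → ∀ A : Set R,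
          A ∈ q ↔ A ∈ DomainPR.scaledFamily (algebraMap R K u / algebraMap R K v) p) ∧
        ∀ A ∈ q, ∃ x ∈ A \ {0}, ∃ y ∈ A \ {0}, ∃ w ∈ A \ {0}, ∃ z ∈ A \ {0},
          a * x + b * y = c * w * z ^ n := by
    intro p hp
    by_cases hu : u = 0
    · refine ⟨p, fun _ => rfl, fun h => absurd hu h, fun A hA => ?_⟩
      -- Since `n ≥ 1`, `u = 0` forces `k = 0`, and only `a + b` can vanish.
      rw [hu, zero_pow hn.ne', mul_zero] at hkuv
      have hk0 : k = 0 := (mul_eq_zero.mp hkuv).resolve_right (pow_ne_zero n hv)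
      have hab : b = -a := by
        rcases hk with h | h | h
        · exact absurd (h ▸ hk0) ha
        · exact absurd (h ▸ hk0) hb
        · exact eq_neg_of_add_eq_zero_right (h ▸ hk0)
      obtain ⟨x, hx, y, hy, w, hw, z, hz, h⟩ :=
        hp.exists_mul_sub_eq (Filter.inter_mem hA hp.compl_zero_mem) ha hc n
      exact ⟨x, hx, y, hy, w, hw, z, hz, by rw [hab, mul_assoc c, ← h]; ring⟩
    · obtain ⟨q, hq⟩ := DomainPR.exists_ultrafilter_scaledFamily (K := K) (u := u) hv
        (hp.multiples v hv)
      exact ⟨q, fun h => absurd h hu, fun _ => hq, fun A hA =>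
        DomainPR.exists_solution_of_mem_scaledFamily ha hb hk hu hv hkuv hp ((hq A).mp hA)⟩
  refine ⟨hmain, fun r C _ hC => ?_⟩
  obtain ⟨p, hp⟩ := DomainPR.exists_isSpecialUltrafilter R
  obtain ⟨q, -, -, hq⟩ := hmain p hp
  -- Every member of `q` contains a nonzero `x`, so `{0}` is not one.
  have h0 : ({0}ᶜ : Set R) ∈ q := by
    rw [Ultrafilter.compl_mem_iff_notMem]
    intro h
    obtain ⟨x, hx, -⟩ := hq _ h
    exact hx.2 hx.1
  rw [← hC, ← Set.biUnion_univ, Ultrafilter.finite_biUnion_mem_iff Set.finite_univ] at h0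
  obtain ⟨i, -, hi⟩ := h0
  obtain ⟨x, hx, y, hy, w, hw, z, hz, h⟩ := hq _ hi
  refine ⟨i, ![⟨x, hx.2⟩, ⟨y, hy.2⟩, ⟨w, hw.2⟩, ⟨z, hz.2⟩], ?_, fun _ => sub_eq_zero.mpr h⟩
  intro j
  fin_cases j
  exacts [hx.1, hy.1, hw.1, hz.1]
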